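/- Let $n$ be the dimension of a finite-dimensional Hilbert space $\mathcal H\cong\mathbb C^n$, write $X>0$ for "$X$ is a positive definite $n\times n$ complex matrix", let $\mathcal P=\{X: X>0\}$, $\mathbb C^+=\{z\in\mathbb C:\operatorname{Im}z>0\}$, and let $I_n^+$ be the set of complex $n\times n$ matrices $T$ with $\frac{1}{2i}(T-T^*)>0$. For $0<p\le 1$ and $B>0$ put $$\mathcal I_{p,B}=\Big\{X\in\mathcal P:\ (zX+H)^{\frac p2}\,B\,(zX+H)^{\frac p2}\in I_n^+\ \text{ for all Hermitian } H \text{ and all } z\in\mathbb C^+\Big\},$$ where $(zX+H)^{p/2}$ is given by the analytic functional calculus with the principal branch of $\zeta\mapsto\zeta^{p/2}$ (the spectrum of $zX+H$ lies in $\mathbb C^+$), and let $$\mathcal I(\mathcal H)=\bigcap_{0<p'\le 1}\ \bigcap_{B>0}\mathcal I_{p',B}.$$ Let $0<p<1$, let $Z$ be an invertible $n\times n$ matrix, put $\Phi_Z(X)=Z^*XZ$, and let $A>0$. Then the map $$X\longmapsto \mathrm{Tr}\Big[\big\{\Phi_Z(X^{p/2})\,A\,\Phi_Z(X^{p/2})\big\}^{1/p}\Big]$$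 is concave on every convex subset of $\mathcal I(\mathcal H)$. More generally, for the given $p$ and $Z$, it is concave on every convex subset of the larger set $\mathcal I_{p,ZZ^*}\supseteq\mathcal I(\mathcal H)$. -/

import Mathlib

open scoped MatrixOrder ComplexOrder

/-- `q` agrees with `f` on the spectrum of the matrix `T`: at every eigenvalue `w` of `T`, of
algebraic multiplicity `m`, the derivatives of `q` and `f` of orders `0, …, m - 1` coincide. -/
def InterpolatesOnSpectrum {n : Type*} [Fintype n] [DecidableEq n]
    (f : ℂ → ℂ) (T : Matrix n n ℂ) (q : Polynomial ℂ) : Prop :=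
  ∀ w : ℂ, ∀ k : ℕ, k < T.charpoly.rootMultiplicity w →
    (Polynomial.derivative^[k] q).eval w = iteratedDeriv k f w

theorem eval_iterate_derivative_eq_taylor (q : Polynomial ℂ) (w : ℂ) (k : ℕ) :
    (Polynomial.derivative^[k] q).eval w = k.factorial * (Polynomial.taylor w q).coeff k := by
  rw [Polynomial.taylor_coeff, ← Polynomial.factorial_smul_hasseDeriv]
  simp

theorem exists_interpolatesOnSpectrum {n : Type*} [Fintype n] [DecidableEq n]
    (f : ℂ → ℂ) (T : Matrix n n ℂ) : ∃ q : Polynomial ℂ, InterpolatesOnSpectrum f T q := by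
  classical
  let m : ℂ → ℕ := fun w => T.charpoly.rootMultiplicity w
  let g : ℂ → Polynomial ℂ := fun w => Polynomial.taylor (-w)
    (∑ k ∈ Finset.range (m w), Polynomial.monomial k (iteratedDeriv k f w / k.factorial))
  have hc : Pairwise (Function.onFun IsCoprime (fun w : T.charpoly.roots.toFinset =>
      Ideal.span {(Polynomial.X - Polynomial.C (w : ℂ)) ^ m w})) := by
    intro a b hab
    rw [Function.onFun, Ideal.isCoprime_span_singleton_iff]
    exact (Polynomial.isCoprime_X_sub_C_of_isUnit_sub
      (sub_ne_zero.2 (fun h => hab (Subtype.ext h))).isUnit).pow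
  obtain ⟨q, hq⟩ := Ideal.exists_forall_sub_mem_ideal hc (fun w => g w)
  refine ⟨q, fun w k hk => ?_⟩
  have hw : w ∈ T.charpoly.roots.toFinset := by
    rw [Multiset.mem_toFinset, ← Multiset.count_pos, Polynomial.count_roots]
    exact lt_of_le_of_lt (Nat.zero_le _) hk
  obtain ⟨c, hc⟩ := Ideal.mem_span_singleton.1 (hq ⟨w, hw⟩)
  have hq' : q = g w + (Polynomial.X - Polynomial.C w) ^ m w * c := by
    rw [← hc]; ring
  have h1 : Polynomial.taylor w (g w) =
      ∑ k ∈ Finset.range (m w), Polynomial.monomial k (iteratedDeriv k f w / k.factorial) := by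
    simp only [g, Polynomial.taylor_taylor]
    simp
  have h2 : Polynomial.taylor w ((Polynomial.X - Polynomial.C w) ^ m w * c) =
      Polynomial.X ^ m w * Polynomial.taylor w c := by
    simp [Polynomial.taylor_mul, Polynomial.taylor_pow]
  rw [eval_iterate_derivative_eq_taylor, hq', map_add, h1, h2, Polynomial.coeff_add,
    Polynomial.coeff_X_pow_mul', if_neg (by simpa [m] using hk)]
  have hk' : k < m w := hk
  simp [Polynomial.coeff_monomial, hk', mul_div_cancel₀, Nat.factorial_ne_zero]

/-- The analytic functional calculus of a complex matrix `T` for a function `f` that is analytic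
near the spectrum of `T`: `f(T) = q(T)` for any polynomial `q` that agrees with `f` on the spectrum
of `T` (with multiplicities). The value does not depend on the choice of `q`
(`matrixFun_eq_aeval`). -/
noncomputable def matrixFun {n : Type*} [Fintype n] [DecidableEq n]
    (f : ℂ → ℂ) (T : Matrix n n ℂ) : Matrix n n ℂ :=
  Polynomial.aeval T (exists_interpolatesOnSpectrum f T).choose

theorem matrixFun_eq_aeval {n : Type*} [Fintype n] [DecidableEq n]
    {f : ℂ → ℂ} {T : Matrix n n ℂ} {q : Polynomial ℂ} (hq : InterpolatesOnSpectrum f T q) :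
    matrixFun f T = Polynomial.aeval T q := by
  rw [matrixFun, ← sub_eq_zero, ← map_sub]
  have hr := (exists_interpolatesOnSpectrum f T).choose_spec
  generalize (exists_interpolatesOnSpectrum f T).choose = r at hr
  by_cases h0 : r - q = 0
  · rw [h0, map_zero]
  have hdvd : T.charpoly ∣ r - q := by
    rw [(IsAlgClosed.splits T.charpoly).eq_prod_roots_of_monic T.charpoly_monic,
      Multiset.prod_X_sub_C_dvd_iff_le_roots h0, Multiset.le_iff_count]
    intro w
    rw [Polynomial.count_roots, Polynomial.count_roots]
    refine le_of_forall_lt fun k hk => ?_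
    rw [Polynomial.lt_rootMultiplicity_iff_isRoot_iterate_derivative h0]
    intro j hj
    rw [Polynomial.IsRoot, Polynomial.iterate_derivative_sub, Polynomial.eval_sub,
      hr w j (hj.trans_lt hk), hq w j (hj.trans_lt hk), sub_self]
  obtain ⟨c, hc⟩ := hdvd
  rw [hc, map_mul, Matrix.aeval_self_charpoly, zero_mul]

/-- `T ^ s` by the analytic functional calculus, with the principal branch of `ζ ↦ ζ ^ s`. -/
noncomputable def matrixCpow {n : Type*} [Fintype n] [DecidableEq n]
    (T : Matrix n n ℂ) (s : ℝ) : Matrix n n ℂ :=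
  matrixFun (fun ζ : ℂ => ζ ^ (s : ℂ)) T

/-- The matrices `T` with positive definite imaginary part `(T - T*) / (2i)`. -/
def upperHalfMatrices (n : Type*) [Fintype n] : Set (Matrix n n ℂ) :=
  {T | ((2 * Complex.I)⁻¹ • (T - T.conjTranspose)).PosDef}

/-- The set of positive definite `X` such that `(zX + H)^{p/2} B (zX + H)^{p/2}` has positive
definite imaginary part for all Hermitian `H` and all `z` in the open upper half plane. -/
def pickSetOf {n : Type*} [Fintype n] [DecidableEq n] (p : ℝ) (B : Matrix n n ℂ) :
    Set (Matrix n n ℂ) :=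
  {X | X.PosDef ∧ ∀ H : Matrix n n ℂ, H.IsHermitian → ∀ z : ℂ, 0 < z.im →
    matrixCpow (z • X + H) (p / 2) * B * matrixCpow (z • X + H) (p / 2) ∈ upperHalfMatrices n}

/-- The set of positive definite `X` such that `(zX + H)^{p/2} B (zX + H)^{p/2}` has positive
definite imaginary part for all Hermitian `H`, all `z` in the open upper half plane, all
`0 < p ≤ 1` and all positive definite `B`. -/
def pickSet (n : Type*) [Fintype n] [DecidableEq n] : Set (Matrix n n ℂ) :=
  {X | X.PosDef ∧ ∀ H : Matrix n n ℂ, H.IsHermitian → ∀ z : ℂ, 0 < z.im →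
    ∀ p : ℝ, 0 < p → p ≤ 1 → ∀ B : Matrix n n ℂ, B.PosDef →
    matrixCpow (z • X + H) (p / 2) * B * matrixCpow (z • X + H) (p / 2) ∈ upperHalfMatrices n}

/-- `Φ_Z(X) = Z* X Z`. -/
def conjMap {n : Type*} [Fintype n] (Z X : Matrix n n ℂ) : Matrix n n ℂ :=
  Z.conjTranspose * X * Z

/-- `Tr[{Φ_Z(X^{p/2}) A Φ_Z(X^{p/2})}^{1/p}]`; the powers are those of positive matrices. -/
noncomputable def pickTrace {n : Type*} [Fintype n] [DecidableEq n] (p : ℝ)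
    (Z A X : Matrix n n ℂ) : ℝ :=
  (Matrix.trace ((conjMap Z (X ^ (p / 2)) * A * conjMap Z (X ^ (p / 2))) ^ (1 / p))).re

/-! ### Analytic functional calculus as a limit of polynomials, and its holomorphic dependence on
the matrix. -/

section FunctionalCalculus

open scoped Topology
open Filter Polynomial

variable {n : Type*} [Fintype n] [DecidableEq n]

open scoped Matrix.Norms.Operator

/-! Concavity is tested along segments, where it becomes a statement about Pick functions. Write
`F(z)` for the trace at `X + zH`, continued analytically with principal branches. The trace is
homogeneous of degree one, so `z F(1/z)` is its value at `W = zX + H`.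

For `Im z > 0`, put `K = Φ_Z(W^{p/2})`. Then `K² = Z*(W^{p/2} ZZ* W^{p/2})Z`, so the hypothesis with
`B = ZZ*` says exactly that `K²` has positive imaginary part. This places every eigenvalue of `KAK`
in the upper half plane (`im_mul_pos_of_mem_spectrum_mul_mul`). Applying the hypothesis to the
reflected matrix `-W*` gives the other bound, so the eigenvalues lie in `0 < arg < πp`
(`sector_of_mem_spectrum_pickInner`). The power `1/p` opens this sector to the upper half plane. The
trace is the sum of the eigenvalues, hence `Im (z F(1/z)) ≥ 0`.

Near infinity, `z F(1/z) = F(0)z + F'(0) + F''(0)/(2z) + O(z⁻²)`, with `F(0)` and `F'(0)` real. A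
maximum principle (`im_nonneg_of_boundary`) shows that subtracting `F(0)z` keeps the imaginary part
nonnegative. Along `z = iy` the leading imaginary part is then `-Re F''(0)/(2y)`, so `Re F''(0) ≤
0`. Applied at every interior point of a segment, this is concavity.

The rest makes the non-normal functional calculus usable: Taylor polynomials on a disc containing
the spectrum give both holomorphy in a parameter and the branch identities for powers. -/

theorem spectrum_subset_iff_charpoly {T : Matrix n n ℂ} {U : Set ℂ} :
    spectrum ℂ T ⊆ U ↔ ∀ w ∈ T.charpoly.roots.toFinset, w ∈ U := by
  refine forall_congr' fun w => ?_
  rw [Matrix.mem_spectrum_iff_isRoot_charpoly, Multiset.mem_toFinset,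
    mem_roots T.charpoly_monic.ne_zero]

theorem aeval_eq_zero_of_derivatives {T : Matrix n n ℂ} {q : ℂ[X]}
    (hq : ∀ w : ℂ, ∀ k < T.charpoly.rootMultiplicity w, (derivative^[k] q).eval w = 0) :
    aeval T q = 0 := by
  have h1 : InterpolatesOnSpectrum (fun _ => 0) T q := fun w k hk => by
    rw [hq w k hk, iteratedDeriv_const]; simp
  have h2 : InterpolatesOnSpectrum (fun _ => 0) T 0 := fun w k hk => by
    rw [iteratedDeriv_const]; simp
  rw [← matrixFun_eq_aeval h1, matrixFun_eq_aeval h2, map_zero]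

/-- Convergence of all derivatives on the spectrum implies convergence of `P N (T)`. -/
theorem tendsto_aeval_of_derivatives {T : Matrix n n ℂ} {P : ℕ → ℂ[X]} {q : ℂ[X]}
    (h : ∀ w : ℂ, ∀ k < T.charpoly.rootMultiplicity w,
      Tendsto (fun N => (derivative^[k] (P N)).eval w) atTop (𝓝 ((derivative^[k] q).eval w))) :
    Tendsto (fun N => aeval T (P N)) atTop (𝓝 (aeval T q)) := by
  -- `aeval T p` depends only on the finite jet `D p` of `p` on the spectrum, so it factors as `L (D
  -- p)` with `L` linear on a finite-dimensional space, hence continuous.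
  let ι := Σ w : T.charpoly.roots.toFinset, Fin (T.charpoly.rootMultiplicity (w : ℂ))
  let D : ℂ[X] →ₗ[ℂ] (ι → ℂ) :=
    LinearMap.pi fun i => (Polynomial.leval (i.1 : ℂ)) ∘ₗ (derivative ^ (i.2 : ℕ))
  have hD (p : ℂ[X]) (i : ι) : D p i = (derivative^[i.2] p).eval (i.1 : ℂ) := by
    simp [D, Module.End.pow_apply]
  obtain ⟨s, hs⟩ := D.rangeRestrict.exists_rightInverse_of_surjective D.range_rangeRestrict
  obtain ⟨L, hL⟩ := LinearMap.exists_extend ((aeval T).toLinearMap ∘ₗ s)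
  have hLD (p : ℂ[X]) : aeval T p = L (D p) := by
    have h1 : L (D p) = aeval T (s (D.rangeRestrict p)) := by
      have := congrArg (fun g => g (D.rangeRestrict p)) hL
      simpa using this
    rw [h1, ← sub_eq_zero, ← map_sub]
    have h2 : D (p - s (D.rangeRestrict p)) = 0 := by
      have h3 := congrArg (fun g => g (D.rangeRestrict p)) hs
      have h4 := congrArg Subtype.val h3
      simp only [LinearMap.comp_apply, LinearMap.id_apply, LinearMap.codRestrict_apply,
        LinearMap.rangeRestrict] at h4
      rw [map_sub, sub_eq_zero]
      exact h4.symm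
    refine aeval_eq_zero_of_derivatives fun w k hk => ?_
    have hw : w ∈ T.charpoly.roots.toFinset := by
      rw [Multiset.mem_toFinset, ← Multiset.count_pos, Polynomial.count_roots]
      exact lt_of_le_of_lt (Nat.zero_le _) hk
    rw [← hD _ ⟨⟨w, hw⟩, ⟨k, hk⟩⟩, h2, Pi.zero_apply]
  have hc : Continuous L := LinearMap.continuous_of_finiteDimensional L
  simp only [hLD]
  refine (hc.tendsto _).comp (tendsto_pi_nhds.2 fun i => ?_)
  simp only [hD]
  exact h _ _ i.2.2

theorem tendstoLocallyUniformlyOn_iterate_derivative {U : Set ℂ} (hU : IsOpen U) {f : ℂ → ℂ}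
    {P : ℕ → ℂ[X]} (h : TendstoLocallyUniformlyOn (fun N z => (P N).eval z) f atTop U) (k : ℕ) :
    TendstoLocallyUniformlyOn (fun N z => (derivative^[k] (P N)).eval z) (iteratedDeriv k f)
      atTop U := by
  induction k with
  | zero => simpa using h
  | succ k ih =>
    have := ih.deriv (Eventually.of_forall fun N => (Polynomial.differentiable _).differentiableOn) hU
    rw [iteratedDeriv_succ]
    convert this using 2 with N
    funext z
    simp only [Function.comp_apply, Function.iterate_succ_apply']
    rw [Polynomial.deriv]

/-- If polynomials converge locally uniformly to `f` near the spectrum of `T`, then their values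
at `T` converge to `f(T)`. -/
theorem tendsto_aeval_matrixFun {U : Set ℂ} (hU : IsOpen U) {f : ℂ → ℂ} {P : ℕ → ℂ[X]}
    (h : TendstoLocallyUniformlyOn (fun N z => (P N).eval z) f atTop U) {T : Matrix n n ℂ}
    (hT : spectrum ℂ T ⊆ U) :
    Tendsto (fun N => aeval T (P N)) atTop (𝓝 (matrixFun f T)) := by
  obtain ⟨q, hq⟩ := exists_interpolatesOnSpectrum f T
  rw [matrixFun_eq_aeval hq]
  refine tendsto_aeval_of_derivatives fun w k hk => ?_
  rw [hq w k hk]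
  refine (tendstoLocallyUniformlyOn_iterate_derivative hU h k).tendsto_at ?_
  refine spectrum_subset_iff_charpoly.1 hT w ?_
  rw [Multiset.mem_toFinset, ← Multiset.count_pos, Polynomial.count_roots]
  exact lt_of_le_of_lt (Nat.zero_le _) hk

/-- The Taylor polynomials of a function. -/
noncomputable def taylorPolynomial (f : ℂ → ℂ) (c : ℂ) (N : ℕ) : ℂ[X] :=
  ∑ k ∈ Finset.range N, C ((k.factorial : ℂ)⁻¹ * iteratedDeriv k f c) * (X - C c) ^ k

theorem summable_taylor_coeff {f : ℂ → ℂ} {c : ℂ} {R r : ℝ}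
    (hf : DifferentiableOn ℂ f (Metric.ball c R)) (hr : 0 ≤ r) (hrR : r < R) :
    Summable fun k : ℕ => ‖(k.factorial : ℂ)⁻¹ * iteratedDeriv k f c‖ * r ^ k := by
  have hz : c + r ∈ Metric.ball c R := by simpa [abs_of_nonneg hr] using hrR
  have := (Complex.hasSum_taylorSeries_on_ball hf hz).summable.norm
  refine this.congr fun k => ?_
  simp only [add_sub_cancel_left, smul_eq_mul, norm_mul, norm_pow, Complex.norm_real,
    Real.norm_of_nonneg hr]
  ring

theorem tendstoLocallyUniformlyOn_taylorPolynomial {f : ℂ → ℂ} {c : ℂ} {R : ℝ}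
    (hf : DifferentiableOn ℂ f (Metric.ball c R)) :
    TendstoLocallyUniformlyOn (fun N z => (taylorPolynomial f c N).eval z) f atTop
      (Metric.ball c R) := by
  rw [tendstoLocallyUniformlyOn_iff_forall_isCompact Metric.isOpen_ball]
  intro K hKc hK
  obtain ⟨r, hr, hrK⟩ : ∃ r < R, ∀ z ∈ K, dist z c ≤ r := by
    rcases K.eq_empty_or_nonempty with rfl | hne
    · exact ⟨R - 1, by linarith, by simp⟩
    · obtain ⟨x, hx, hx'⟩ := hK.exists_isMaxOn hne
        (continuous_id.dist (continuous_const (y := c))).continuousOn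
      exact ⟨dist x c, hKc hx, fun z hz => hx' hz⟩
  rcases K.eq_empty_or_nonempty with rfl | ⟨x, hx⟩
  · exact tendstoUniformlyOn_empty
  have hr0 : 0 ≤ r := dist_nonneg.trans (hrK x hx)
  have h1 := tendstoUniformlyOn_tsum_nat (f := fun (k : ℕ) z =>
    (k.factorial : ℂ)⁻¹ * iteratedDeriv k f c * (z - c) ^ k) (s := K)
    (summable_taylor_coeff hf hr0 hr) (fun k z hz => by
      rw [norm_mul, norm_pow]
      gcongr
      rw [← dist_eq_norm]; exact hrK z hz)
  refine (h1.congr_right fun z hz => ?_).congr (Eventually.of_forall fun N z hz => ?_)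
  · exact Complex.taylorSeries_eq_on_ball' (hKc hz) hf
  · simp [taylorPolynomial, eval_finsetSum]

theorem tendsto_taylor_matrixFun {f : ℂ → ℂ} {c : ℂ} {R : ℝ}
    (hf : DifferentiableOn ℂ f (Metric.ball c R)) {T : Matrix n n ℂ}
    (hT : spectrum ℂ T ⊆ Metric.ball c R) :
    Tendsto (fun N => ∑ k ∈ Finset.range N,
      ((k.factorial : ℂ)⁻¹ * iteratedDeriv k f c) • (T - c • (1 : Matrix n n ℂ)) ^ k)
      atTop (𝓝 (matrixFun f T)) := by
  have := tendsto_aeval_matrixFun Metric.isOpen_ball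
    (tendstoLocallyUniformlyOn_taylorPolynomial hf) hT
  refine this.congr fun N => ?_
  simp only [taylorPolynomial, map_sum, map_mul, aeval_C, map_pow, map_sub, aeval_X]
  simp only [Algebra.algebraMap_eq_smul_one, smul_mul_assoc, one_mul, mul_smul]

theorem spectrum_sub_smul_one {T : Matrix n n ℂ} {c w : ℂ}
    (hw : w ∈ spectrum ℂ (T - c • (1 : Matrix n n ℂ))) : w + c ∈ spectrum ℂ T := by
  rw [← Algebra.algebraMap_eq_smul_one] at hw
  have h := (spectrum.add_mem_iff (R := ℂ) (a := T) (r := w) (s := c)).2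
  apply h
  rwa [neg_add_eq_sub]

/-- Gelfand's formula: the spectral radius of `T - c` is below `R`, so some power beats `r ^ k`
strictly. One strict inequality for one power is an open condition on `T`, which the spectral radius
bound does not give directly. -/
theorem exists_norm_pow_lt {T : Matrix n n ℂ} {c : ℂ} {R : ℝ}
    (hR : 0 < R) (hT : spectrum ℂ T ⊆ Metric.ball c R) :
    ∃ r, 0 < r ∧ r < R ∧ ∃ k : ℕ, 0 < k ∧ ‖(T - c • (1 : Matrix n n ℂ)) ^ k‖ < r ^ k := by
  set S := T - c • (1 : Matrix n n ℂ) with hS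
  have hρ : spectralRadius ℂ S < ENNReal.ofReal R := by
    rcases (spectrum ℂ S).eq_empty_or_nonempty with h0 | hne
    · rw [spectralRadius, h0]; simpa using hR
    · obtain ⟨w, hw, hw'⟩ := spectrum.exists_nnnorm_eq_spectralRadius_of_nonempty hne
      rw [← hw', ← enorm_eq_nnnorm, ← ofReal_norm]
      refine (ENNReal.ofReal_lt_ofReal_iff hR).2 ?_
      have := hT (spectrum_sub_smul_one hw)
      simpa using this
  obtain ⟨r, hr1, hr2⟩ := ENNReal.lt_iff_exists_real_btwn.1 hρ
  obtain ⟨hr3, hr4⟩ := hr2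
  have hr0 : 0 < r := ENNReal.ofReal_pos.1 ((zero_le).trans_lt hr3)
  refine ⟨r, hr0, (ENNReal.ofReal_lt_ofReal_iff hR).1 hr4, ?_⟩
  have h1 := (spectrum.pow_norm_pow_one_div_tendsto_nhds_spectralRadius S).eventually_lt_const hr3
  obtain ⟨k, hk, hk0⟩ := (h1.and (eventually_gt_atTop 0)).exists
  refine ⟨k, hk0, ?_⟩
  have h2 := (ENNReal.ofReal_lt_ofReal_iff hr0).1 hk
  have h3 := pow_lt_pow_left₀ h2 (by positivity) hk0.ne'
  rwa [← Real.rpow_natCast, ← Real.rpow_mul (norm_nonneg _), one_div,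
    inv_mul_cancel₀ (by exact_mod_cast hk0.ne'), Real.rpow_one] at h3

theorem norm_pow_le_of_norm_pow_le {A : Type*} [NormedRing A] {S : A} {r M : ℝ} (hr : 0 < r)
    {k : ℕ} (hk : 0 < k) (h : ‖S ^ k‖ ≤ r ^ k) (hM : ∀ j < k, ‖S ^ j‖ ≤ M * r ^ j) (m : ℕ) :
    ‖S ^ m‖ ≤ M * r ^ m := by
  induction m using Nat.strong_induction_on with
  | _ m ih =>
    rcases lt_or_ge m k with hm | hm
    · exact hM m hm
    · obtain ⟨l, rfl⟩ := Nat.exists_eq_add_of_le hm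
      rw [pow_add]
      calc ‖S ^ k * S ^ l‖ ≤ ‖S ^ k‖ * ‖S ^ l‖ := norm_mul_le _ _
        _ ≤ r ^ k * (M * r ^ l) := by
          gcongr
          exact ih l (by omega)
        _ = M * r ^ (k + l) := by ring

/-- Only the powers of order at most `k` need control. These are finitely many continuous
conditions, and submultiplicativity propagates them to all powers. The resulting uniform bound
dominates the Taylor series on a whole neighbourhood. -/
theorem eventually_forall_norm_pow_le {S : Matrix n n ℂ} {r : ℝ} (hr : 0 < r) {k : ℕ} (hk : 0 < k)
    (h : ‖S ^ k‖ < r ^ k) : ∃ M : ℝ, ∀ᶠ S' in 𝓝 S, ∀ m, ‖S' ^ m‖ ≤ M * r ^ m := by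
  let M : ℝ := ∑ j ∈ Finset.range k, (‖S ^ j‖ + 1) / r ^ j
  refine ⟨M, ?_⟩
  have h1 : ∀ᶠ S' in 𝓝 S, ‖S' ^ k‖ < r ^ k :=
    (continuous_pow k).norm.tendsto S |>.eventually_lt_const h
  have h2 : ∀ᶠ S' in 𝓝 S, ∀ j ∈ Finset.range k, ‖S' ^ j‖ < ‖S ^ j‖ + 1 := by
    rw [Filter.eventually_all_finset]
    exact fun j _ => (continuous_pow j).norm.tendsto S |>.eventually_lt_const (by simp)
  filter_upwards [h1, h2] with S' h1 h2
  refine norm_pow_le_of_norm_pow_le hr hk h1.le fun j hj => ?_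
  have h3 : (‖S ^ j‖ + 1) / r ^ j ≤ M := by
    refine Finset.single_le_sum (f := fun j => (‖S ^ j‖ + 1) / r ^ j)
      (fun i _ => by positivity) (Finset.mem_range.2 hj)
  rw [div_le_iff₀ (by positivity)] at h3
  exact (h2 j (Finset.mem_range.2 hj)).le.trans h3

theorem norm_le_of_mem_spectrum_of_norm_pow_le {S : Matrix n n ℂ} {r M : ℝ} (hr : 0 < r)
    (h : ∀ m, ‖S ^ m‖ ≤ M * r ^ m) {w : ℂ} (hw : w ∈ spectrum ℂ S) : ‖w‖ ≤ r := by
  by_contra! hlt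
  have h1 : ∀ m : ℕ, (‖w‖ / r) ^ m ≤ M * ‖(1 : Matrix n n ℂ)‖ := fun m => by
    have h2 := spectrum.norm_le_norm_mul_of_mem (spectrum.pow_mem_pow S m hw)
    rw [norm_pow] at h2
    rw [div_pow, div_le_iff₀ (by positivity)]
    calc _ ≤ _ := h2
      _ ≤ M * r ^ m * ‖(1 : Matrix n n ℂ)‖ := by gcongr; exact h m
      _ = _ := by ring
  obtain ⟨m, hm⟩ := pow_unbounded_of_one_lt (M * ‖(1 : Matrix n n ℂ)‖) ((one_lt_div hr).2 hlt)
  exact (h1 m).not_gt hm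

/-- `z ↦ f(W(z))` is holomorphic. -/
theorem eventually_differentiableAt_matrixFun {f : ℂ → ℂ} {c : ℂ} {R : ℝ} (hR : 0 < R)
    (hf : DifferentiableOn ℂ f (Metric.ball c R)) {W : ℂ → Matrix n n ℂ} {z₀ : ℂ}
    (hW : ∀ᶠ z in 𝓝 z₀, DifferentiableAt ℂ W z) (hT : spectrum ℂ (W z₀) ⊆ Metric.ball c R) :
    ∀ᶠ z in 𝓝 z₀, DifferentiableAt ℂ (fun z => matrixFun f (W z)) z := by
  obtain ⟨r, hr0, hrR, k, hk, hk'⟩ := exists_norm_pow_lt hR hT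
  obtain ⟨M, hM⟩ := eventually_forall_norm_pow_le hr0 hk hk'
  have hc : ContinuousAt (fun z => W z - c • (1 : Matrix n n ℂ)) z₀ :=
    hW.self_of_nhds.continuousAt.sub continuousAt_const
  obtain ⟨V, hV, hVo, hz₀⟩ := eventually_nhds_iff.1 (hW.and (hc.tendsto.eventually hM))
  have hsum : Summable fun k : ℕ =>
      ‖(k.factorial : ℂ)⁻¹ * iteratedDeriv k f c‖ * r ^ k * M :=
    (summable_taylor_coeff hf hr0.le hrR).mul_right M
  have hbound : ∀ (k : ℕ) (z : ℂ), z ∈ V → ‖((k.factorial : ℂ)⁻¹ * iteratedDeriv k f c) •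
      (W z - c • (1 : Matrix n n ℂ)) ^ k‖ ≤
      ‖(k.factorial : ℂ)⁻¹ * iteratedDeriv k f c‖ * r ^ k * M := fun k z hz => by
    rw [norm_smul, mul_assoc, mul_comm (r ^ k)]
    gcongr
    exact (hV z hz).2 k
  have hd := Complex.differentiableOn_tsum_of_summable_norm hsum (F := fun k z =>
    ((k.factorial : ℂ)⁻¹ * iteratedDeriv k f c) • (W z - c • (1 : Matrix n n ℂ)) ^ k)
    (fun k z hz => by
      have h := (hV z hz).1
      exact DifferentiableAt.differentiableWithinAt (by fun_prop)) hVo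
    hbound
  -- The power bound also keeps the spectrum of `W z` inside the disc for `z` near `z₀`, so the
  -- series really sums to `matrixFun f (W z)` there.
  have heq : ∀ z ∈ V, matrixFun f (W z) = ∑' k : ℕ, ((k.factorial : ℂ)⁻¹ * iteratedDeriv k f c) •
      (W z - c • (1 : Matrix n n ℂ)) ^ k := fun z hz => by
    have hs : Summable fun k : ℕ => ((k.factorial : ℂ)⁻¹ * iteratedDeriv k f c) •
      (W z - c • (1 : Matrix n n ℂ)) ^ k := Summable.of_norm_bounded hsum fun k => hbound k z hz
    refine tendsto_nhds_unique (tendsto_taylor_matrixFun hf fun w hw => ?_) hs.hasSum.tendsto_sum_nat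
    have h1 : w - c ∈ spectrum ℂ (W z - c • (1 : Matrix n n ℂ)) := by
      rw [← Algebra.algebraMap_eq_smul_one, ← neg_add_eq_sub (algebraMap ℂ (Matrix n n ℂ) c),
        ← spectrum.add_mem_iff]
      simpa using hw
    rw [Metric.mem_ball, dist_eq_norm]
    exact (norm_le_of_mem_spectrum_of_norm_pow_le hr0 (hV z hz).2 h1).trans_lt hrR
  filter_upwards [hVo.mem_nhds hz₀] with z hz
  exact ((hd z hz).congr heq (heq z hz)).differentiableAt (hVo.mem_nhds hz)

end FunctionalCalculus

/-! ### Branch identities for matrix powers. -/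

section MatrixPowers

open scoped Topology
open Filter Polynomial

variable {n : Type*} [Fintype n] [DecidableEq n]

open scoped Matrix.Norms.Operator

/-- An open half plane is the increasing union of the discs tangent to its boundary at `0`: `‖w -
ρu‖ < ρ` means `‖w‖² < 2ρ Re(ū w)`. A single Taylor series of `ζ ^ s` therefore serves the whole
spectrum. -/
theorem exists_ball_of_finite_of_halfPlane {S : Set ℂ} (hS : S.Finite) {u : ℂ} (hu : ‖u‖ = 1)
    (h : ∀ w ∈ S, 0 < (star u * w).re) : ∃ R : ℝ, 0 < R ∧ S ⊆ Metric.ball (R * u) R := by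
  obtain ⟨R, hR⟩ := (hS.image fun w => ‖w‖ ^ 2 / (2 * (star u * w).re)).bddAbove
  refine ⟨max R 0 + 1, by positivity, fun w hw => ?_⟩
  set ρ := max R 0 + 1
  have hρ : 0 < ρ := by positivity
  have h1 : ‖w‖ ^ 2 / (2 * (star u * w).re) < ρ :=
    (hR (Set.mem_image_of_mem _ hw)).trans_lt ((le_max_left _ _).trans_lt (lt_add_one _))
  rw [div_lt_iff₀ (by linarith [h w hw])] at h1
  rw [Metric.mem_ball, dist_eq_norm]
  refine lt_of_pow_lt_pow_left₀ 2 hρ.le ?_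
  have hu2 : u.re ^ 2 + u.im ^ 2 = 1 := by
    have := Complex.sq_norm u
    rw [hu, Complex.normSq_apply] at this; linarith
  have h2 : ‖w - ρ * u‖ ^ 2 = ‖w‖ ^ 2 - ρ * (2 * (star u * w).re) + ρ ^ 2 := by
    simp only [Complex.sq_norm, Complex.normSq_apply, Complex.sub_re, Complex.sub_im,
      Complex.mul_re, Complex.mul_im, Complex.ofReal_re, Complex.ofReal_im, Complex.star_def,
      Complex.conj_re, Complex.conj_im]
    linear_combination ρ ^ 2 * hu2
  rw [h2]; linarith

theorem finite_spectrum (T : Matrix n n ℂ) : (spectrum ℂ T).Finite := by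
  refine T.charpoly.roots.toFinset.finite_toSet.subset ?_
  exact spectrum_subset_iff_charpoly.2 fun w hw => hw

theorem exists_ball_of_spectrum_im_pos {T : Matrix n n ℂ} (hT : ∀ w ∈ spectrum ℂ T, 0 < w.im) :
    ∃ R : ℝ, 0 < R ∧ spectrum ℂ T ⊆ Metric.ball (R * Complex.I) R :=
  exists_ball_of_finite_of_halfPlane (finite_spectrum T) (by simp) fun w hw => by
    simpa using hT w hw

theorem exists_ball_of_spectrum_re_pos {T : Matrix n n ℂ} (hT : ∀ w ∈ spectrum ℂ T, 0 < w.re) :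
    ∃ R : ℝ, 0 < R ∧ spectrum ℂ T ⊆ Metric.ball (R : ℂ) R := by
  simpa using exists_ball_of_finite_of_halfPlane (u := 1) (finite_spectrum T) (by simp)
    fun w hw => by simpa using hT w hw

theorem im_pos_of_mem_ball {R : ℝ} {w : ℂ} (hw : w ∈ Metric.ball (R * Complex.I) R) :
    0 < w.im := by
  rw [Metric.mem_ball, dist_eq_norm] at hw
  have := (Complex.abs_im_le_norm _).trans_lt hw
  simp only [Complex.sub_im, Complex.mul_im, Complex.ofReal_re, Complex.I_im, Complex.ofReal_im,
    Complex.I_re] at this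
  linarith [(abs_lt.1 this).1]

theorem re_pos_of_mem_ball {R : ℝ} {w : ℂ} (hw : w ∈ Metric.ball (R : ℂ) R) : 0 < w.re := by
  rw [Metric.mem_ball, dist_eq_norm] at hw
  have := (Complex.abs_re_le_norm _).trans_lt hw
  simp only [Complex.sub_re, Complex.ofReal_re] at this
  linarith [(abs_lt.1 this).1]

theorem differentiableOn_cpow_const {U : Set ℂ} (hU : U ⊆ Complex.slitPlane) (s : ℂ) :
    DifferentiableOn ℂ (fun ζ : ℂ => ζ ^ s) U := fun _ hw =>
  (differentiableAt_id.cpow_const (hU hw)).differentiableWithinAt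

theorem differentiableOn_cpow_ball_im (s : ℂ) (R : ℝ) :
    DifferentiableOn ℂ (fun ζ : ℂ => ζ ^ s) (Metric.ball (R * Complex.I) R) :=
  differentiableOn_cpow_const (fun _ hw => Or.inr (im_pos_of_mem_ball hw).ne') s

theorem differentiableOn_cpow_ball_re (s : ℂ) (R : ℝ) :
    DifferentiableOn ℂ (fun ζ : ℂ => ζ ^ s) (Metric.ball (R : ℂ) R) :=
  differentiableOn_cpow_const (fun _ hw => Or.inl (re_pos_of_mem_ball hw)) s

/-- `z ↦ W(z) ^ s` is holomorphic near a point where the spectrum is in the upper half plane. -/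
theorem eventually_differentiableAt_matrixCpow_of_im_pos {W : ℂ → Matrix n n ℂ} {z₀ : ℂ}
    (hW : ∀ᶠ z in 𝓝 z₀, DifferentiableAt ℂ W z) (hT : ∀ w ∈ spectrum ℂ (W z₀), 0 < w.im) (s : ℝ) :
    ∀ᶠ z in 𝓝 z₀, DifferentiableAt ℂ (fun z => matrixCpow (W z) s) z := by
  obtain ⟨R, hR, hR'⟩ := exists_ball_of_spectrum_im_pos hT
  exact eventually_differentiableAt_matrixFun hR (differentiableOn_cpow_ball_im s R) hW hR'

/-- `z ↦ W(z) ^ s` is holomorphic near a point where the spectrum is in the right half plane. -/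
theorem eventually_differentiableAt_matrixCpow_of_re_pos {W : ℂ → Matrix n n ℂ} {z₀ : ℂ}
    (hW : ∀ᶠ z in 𝓝 z₀, DifferentiableAt ℂ W z) (hT : ∀ w ∈ spectrum ℂ (W z₀), 0 < w.re) (s : ℝ) :
    ∀ᶠ z in 𝓝 z₀, DifferentiableAt ℂ (fun z => matrixCpow (W z) s) z := by
  obtain ⟨R, hR, hR'⟩ := exists_ball_of_spectrum_re_pos hT
  exact eventually_differentiableAt_matrixFun hR (differentiableOn_cpow_ball_re s R) hW hR'

theorem arg_mem_Ioo_of_im_pos {w : ℂ} (hw : 0 < w.im) :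
    0 < Complex.arg w ∧ Complex.arg w < Real.pi := by
  refine ⟨lt_of_le_of_ne (Complex.arg_nonneg_iff.2 hw.le) fun h => ?_,
    Complex.arg_lt_pi_iff.2 (Or.inr hw.ne')⟩
  have := Complex.arg_eq_zero_iff.1 h.symm
  exact hw.ne' this.2

/-- Both arguments lie in `(0, π)`, so their difference lies in `(-π, π)` and no branch cut is
crossed. -/
theorem cpow_div_of_im_pos {a u : ℂ} (ha : 0 < a.im) (hu : 0 < u.im) (s : ℂ) :
    u ^ s = a ^ s * (a⁻¹ * u) ^ s := by
  have ha0 : a ≠ 0 := fun h => by simp [h] at ha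
  have hu0 : u ≠ 0 := fun h => by simp [h] at hu
  have h1 := arg_mem_Ioo_of_im_pos ha
  have h2 := arg_mem_Ioo_of_im_pos hu
  have h3 : (a⁻¹).arg = -a.arg := by rw [Complex.arg_inv, if_neg h1.2.ne]
  have h4 : (a⁻¹ * u).arg = u.arg - a.arg := by
    rw [Complex.arg_mul (inv_ne_zero ha0) hu0, h3]
    · ring
    · rw [h3]; constructor <;> linarith
  conv_lhs => rw [show u = a * (a⁻¹ * u) by rw [mul_inv_cancel_left₀ ha0]]
  have hau : a⁻¹ * u ≠ 0 := mul_ne_zero (inv_ne_zero ha0) hu0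
  have h5 : a.arg + (a⁻¹ * u).arg ∈ Set.Ioc (-Real.pi) Real.pi := by
    rw [h4]; constructor <;> linarith
  rw [Complex.cpow_def_of_ne_zero (mul_ne_zero ha0 hau), Complex.cpow_def_of_ne_zero ha0,
    Complex.cpow_def_of_ne_zero hau, (Complex.log_mul_eq_add_log_iff ha0 hau).2 h5, add_mul,
    Complex.exp_add]

theorem spectrum_smul_matrix {a : ℂ} (ha : a ≠ 0) (T : Matrix n n ℂ) {w : ℂ}
    (hw : w ∈ spectrum ℂ T) : a * w ∈ spectrum ℂ (a • T) := by
  have := (spectrum.smul_mem_smul_iff (a := T) (s := w) (r := Units.mk0 a ha)).2 hw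
  simpa [Units.smul_def] using this

/-- The spectrum of `T` itself may leave the upper half plane. Polynomials `P N` approximating `ζ ^
s` on a disc around the spectrum of `a • T` are rescaled to `a⁻ˢ P N (a ζ)`, which approximate `ζ ^
s` around the spectrum of `T`; the two limits are compared. -/
theorem matrixCpow_smul {a : ℂ} (ha : 0 < a.im) {T : Matrix n n ℂ}
    (hT : ∀ w ∈ spectrum ℂ (a • T), 0 < w.im) (s : ℝ) :
    matrixCpow (a • T) s = a ^ (s : ℂ) • matrixCpow T s := by
  have ha0 : a ≠ 0 := fun h => by simp [h] at ha
  have has : a ^ (s : ℂ) ≠ 0 := by simp [Complex.cpow_eq_zero_iff, ha0]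
  obtain ⟨R, hR, hR'⟩ := exists_ball_of_spectrum_im_pos hT
  set c := (R : ℂ) * Complex.I
  have h1 := tendstoLocallyUniformlyOn_taylorPolynomial (differentiableOn_cpow_ball_im s R)
  set P := taylorPolynomial (fun ζ : ℂ => ζ ^ (s : ℂ)) c
  have hlim := tendsto_aeval_matrixFun Metric.isOpen_ball h1 hR'
  have hcont : Continuous fun w : ℂ => a * w := continuous_const_mul a
  let V : Set ℂ := (fun w => a * w) ⁻¹' Metric.ball c R
  have hV : IsOpen V := Metric.isOpen_ball.preimage hcont
  have h2 : TendstoLocallyUniformlyOn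
      (fun N z => (C (a ^ (s : ℂ))⁻¹ * (P N).comp (C a * X)).eval z) (fun ζ => ζ ^ (s : ℂ))
      atTop V := by
    have h3 := h1.comp (fun w => a * w) (Set.mapsTo_preimage _ _) hcont.continuousOn
    have h4 := (uniformContinuous_const_smul (M := ℂ) (X := ℂ)
      ((a ^ (s : ℂ))⁻¹)).comp_tendstoLocallyUniformlyOn h3
    refine (h4.congr fun N z hz => ?_).congr_right fun z hz => ?_
    · simp
    · have := cpow_div_of_im_pos ha (im_pos_of_mem_ball hz) (s : ℂ)
      simp only [Function.comp_apply, smul_eq_mul, this, inv_mul_cancel_left₀ ha0,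
        inv_mul_cancel_left₀ has]
  have hTV : spectrum ℂ T ⊆ V := fun w hw => hR' (spectrum_smul_matrix ha0 T hw)
  have hlim2 := tendsto_aeval_matrixFun hV h2 hTV
  have heq : ∀ N, aeval T (C (a ^ (s : ℂ))⁻¹ * (P N).comp (C a * X)) =
      (a ^ (s : ℂ))⁻¹ • aeval (a • T) (P N) := fun N => by
    rw [map_mul, aeval_C, aeval_comp, map_mul, aeval_C, aeval_X, Algebra.smul_def,
      Algebra.smul_def]
  simp only [heq] at hlim2
  have := tendsto_nhds_unique hlim2 (hlim.const_smul _)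
  rw [matrixCpow, matrixCpow, this, smul_inv_smul₀ has]

/-- The reflection `w ↦ -w̄` sends the argument `θ` to `π - θ`, so the conjugated power has argument
`s(θ - π)`. -/
theorem neg_star_cpow {w : ℂ} (hw : 0 < w.im) (s : ℝ) :
    star ((-star w) ^ (s : ℂ)) = Complex.exp (-(Real.pi * s * Complex.I)) * w ^ (s : ℂ) := by
  have hw0 : w ≠ 0 := fun h => by simp [h] at hw
  have h1 := arg_mem_Ioo_of_im_pos hw
  have h2 : (star w).arg = -w.arg := by
    rw [Complex.star_def, Complex.arg_conj, if_neg h1.2.ne]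
  have h3 : (-star w).arg = Real.pi - w.arg := by
    rw [Complex.arg_neg_eq_arg_add_pi_of_im_neg, h2]
    · ring
    · simpa using hw
  rw [Complex.cpow_def_of_ne_zero (by simpa using hw0), Complex.cpow_def_of_ne_zero hw0,
    Complex.star_def, ← Complex.exp_conj, ← Complex.exp_add]
  congr 1
  apply Complex.ext
  · simp [Complex.log_re, Complex.log_im]
  · rw [Complex.star_def] at h3
    simp only [map_mul, Complex.mul_im, Complex.conj_re, Complex.conj_im, Complex.log_re,
      Complex.log_im, h3, Complex.ofReal_re, Complex.ofReal_im, Complex.add_im, Complex.neg_im,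
      Complex.mul_re, Complex.I_re, Complex.I_im]
    ring

theorem aeval_map_star_comp_neg (W : Matrix n n ℂ) (P : ℂ[X]) :
    aeval W ((P.map (starRingEnd ℂ)).comp (-X)) = (aeval (-W.conjTranspose) P).conjTranspose := by
  rw [aeval_comp, map_neg, aeval_X]
  induction P using Polynomial.induction_on' with
  | add p q hp hq => simp [hp, hq]
  | monomial k a =>
    simp [aeval_monomial, Matrix.conjTranspose_pow,
      Algebra.algebraMap_eq_smul_one]

theorem eval_map_star_comp_neg (w : ℂ) (P : ℂ[X]) :
    ((P.map (starRingEnd ℂ)).comp (-X)).eval w = star (P.eval (-star w)) := by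
  rw [eval_comp, eval_neg, eval_X]
  induction P using Polynomial.induction_on' with
  | add p q hp hq => simp [hp, hq]
  | monomial k a => simp

theorem mem_spectrum_neg_conjTranspose {W : Matrix n n ℂ} {w : ℂ}
    (hw : w ∈ spectrum ℂ (-W.conjTranspose)) : -star w ∈ spectrum ℂ W := by
  have h1 : -w ∈ spectrum ℂ (star W) := by
    have := spectrum.neg_eq (R := ℂ) (a := star W)
    rw [← Set.mem_neg, this]
    exact hw
  rw [spectrum.map_star, Set.mem_star] at h1
  simpa using h1

/-- Matrix form of `neg_star_cpow`, obtained by reflecting the approximating polynomials. It turns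
the hypothesis at `-W*` into a second condition on the powers of `W`. -/
theorem conjTranspose_matrixCpow_neg_conjTranspose {W : Matrix n n ℂ}
    (hW : ∀ w ∈ spectrum ℂ W, 0 < w.im) (s : ℝ) :
    (matrixCpow (-W.conjTranspose) s).conjTranspose =
      Complex.exp (-(Real.pi * s * Complex.I)) • matrixCpow W s := by
  have hW' : ∀ w ∈ spectrum ℂ (-W.conjTranspose), 0 < w.im := fun w hw => by
    simpa using hW _ (mem_spectrum_neg_conjTranspose hw)
  set e := Complex.exp (-(Real.pi * s * Complex.I))
  have he : e ≠ 0 := Complex.exp_ne_zero _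
  obtain ⟨R, hR, hR'⟩ := exists_ball_of_spectrum_im_pos hW'
  set c := (R : ℂ) * Complex.I
  have h1 := tendstoLocallyUniformlyOn_taylorPolynomial (differentiableOn_cpow_ball_im s R)
  set P := taylorPolynomial (fun ζ : ℂ => ζ ^ (s : ℂ)) c
  have hlim := tendsto_aeval_matrixFun Metric.isOpen_ball h1 hR'
  have hcont : Continuous fun w : ℂ => -star w := continuous_star.neg
  let V : Set ℂ := (fun w => -star w) ⁻¹' Metric.ball c R
  have hV : IsOpen V := Metric.isOpen_ball.preimage hcont
  have h2 : TendstoLocallyUniformlyOn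
      (fun N z => (C e⁻¹ * ((P N).map (starRingEnd ℂ)).comp (-X)).eval z) (fun ζ => ζ ^ (s : ℂ))
      atTop V := by
    have h3 := h1.comp (fun w => -star w) (Set.mapsTo_preimage _ _) hcont.continuousOn
    have h4 := ((uniformContinuous_const_smul (M := ℂ) (X := ℂ) e⁻¹).comp
      (Complex.isometry_conj.uniformContinuous)).comp_tendstoLocallyUniformlyOn h3
    refine (h4.congr fun N z hz => ?_).congr_right fun z hz => ?_
    · simp only [eval_mul, eval_map_star_comp_neg, eval_C, Function.comp_apply, smul_eq_mul]
      rfl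
    · have h5 := im_pos_of_mem_ball hz
      have := neg_star_cpow (w := z) (by simpa using h5) s
      simp only [Function.comp_apply, smul_eq_mul]
      rw [← Complex.star_def, this, inv_mul_cancel_left₀ he]
  have hWV : spectrum ℂ W ⊆ V := fun w hw => hR' (by
    have h6 := mem_spectrum_neg_conjTranspose (W := -W.conjTranspose) (w := w)
      (by simpa using hw)
    simpa using h6)
  have hlim2 := tendsto_aeval_matrixFun hV h2 hWV
  have heq : ∀ N, aeval W (C e⁻¹ * ((P N).map (starRingEnd ℂ)).comp (-X)) =
      e⁻¹ • (aeval (-W.conjTranspose) (P N)).conjTranspose := fun N => by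
    rw [map_mul, aeval_C, aeval_map_star_comp_neg, Algebra.smul_def]
  simp only [heq] at hlim2
  have h7 : Tendsto (fun N => (aeval (-W.conjTranspose) (P N)).conjTranspose) atTop
      (𝓝 (matrixCpow (-W.conjTranspose) s).conjTranspose) :=
    ((continuous_id.matrix_conjTranspose).tendsto _).comp hlim
  have := tendsto_nhds_unique hlim2 (h7.const_smul _)
  rw [matrixCpow.eq_def W, this, smul_inv_smul₀ he]

theorem aeval_diagonal (d : n → ℂ) (q : ℂ[X]) :
    aeval (Matrix.diagonal d) q = Matrix.diagonal fun i => q.eval (d i) := by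
  induction q using Polynomial.induction_on' with
  | add p q hp hq => simp [hp, hq, Matrix.diagonal_add]
  | monomial k a =>
    simp [aeval_monomial, Matrix.diagonal_pow, Algebra.algebraMap_eq_smul_one,
      Matrix.smul_eq_diagonal_mul, Pi.pow_def]

theorem matrixCpow_eq_rpow {X : Matrix n n ℂ} (hX : X.PosDef) (s : ℝ) : matrixCpow X s = X ^ s := by
  obtain ⟨q, hq⟩ := exists_interpolatesOnSpectrum (fun ζ : ℂ => ζ ^ (s : ℂ)) X
  rw [matrixCpow, matrixFun_eq_aeval hq, CFC.rpow_eq_cfc_real hX.posSemidef.nonneg,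
    hX.1.cfc_eq, Matrix.IsHermitian.cfc]
  conv_lhs => rw [hX.1.spectral_theorem]
  rw [Polynomial.aeval_algHom_apply, aeval_diagonal]
  congr 2
  funext i
  have h1 := hq (hX.1.eigenvalues i) 0 ?_
  · simp only [Function.iterate_zero, id, iteratedDeriv_zero] at h1
    simp only [Function.comp_apply]
    refine h1.trans ?_
    rw [← Complex.ofReal_cpow (hX.eigenvalues_pos i).le]
    rfl
  · rw [Polynomial.rootMultiplicity_pos X.charpoly_monic.ne_zero,
      ← Matrix.mem_spectrum_iff_isRoot_charpoly]
    have := hX.1.spectrum_eq_image_range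
    rw [this]
    exact ⟨_, ⟨i, rfl⟩, rfl⟩

theorem posDef_rpow {X : Matrix n n ℂ} (hX : X.PosDef) (s : ℝ) : (X ^ s).PosDef :=
  Matrix.isStrictlyPositive_iff_posDef.1 (hX.isStrictlyPositive.rpow X s)

end MatrixPowers

/-! ### Location of the eigenvalues, homogeneity and holomorphy of the continued trace. -/

section Sector

open scoped Topology
open Filter Polynomial

variable {n : Type*} [Fintype n]

open scoped Matrix

theorem im_dotProduct_pos_of_mem_upperHalfMatrices {T : Matrix n n ℂ}
    (hT : T ∈ upperHalfMatrices n) {v : n → ℂ} (hv : v ≠ 0) : 0 < (star v ⬝ᵥ (T *ᵥ v)).im := by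
  have h1 : 0 < star v ⬝ᵥ (((2 * Complex.I)⁻¹ • (T - Tᴴ)) *ᵥ v) :=
    Matrix.PosDef.dotProduct_mulVec_pos hT hv
  have h2 : star v ⬝ᵥ (Tᴴ *ᵥ v) = star (star v ⬝ᵥ (T *ᵥ v)) := by
    rw [Matrix.star_dotProduct, Matrix.star_mulVec, Matrix.conjTranspose_conjTranspose,
      ← Matrix.dotProduct_mulVec]
  rw [Matrix.smul_mulVec, dotProduct_smul, Matrix.sub_mulVec, dotProduct_sub, h2] at h1
  have h3 := (Complex.lt_def.1 h1).1
  simpa using h3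

theorem smul_add_mem_upperHalfMatrices {X H : Matrix n n ℂ} (hX : X.PosDef) (hH : H.IsHermitian)
    {z : ℂ} (hz : 0 < z.im) : z • X + H ∈ upperHalfMatrices n := by
  have h : (2 * Complex.I)⁻¹ • ((z • X + H) - (z • X + H)ᴴ) = z.im • X := by
    rw [Matrix.conjTranspose_add, Matrix.conjTranspose_smul, hX.1.eq, hH.eq, add_sub_add_right_eq_sub,
      ← sub_smul, smul_smul, ← Complex.coe_smul]
    congr 1
    rw [Complex.star_def, Complex.sub_conj]
    field_simp
    norm_num
  rw [upperHalfMatrices, Set.mem_ofPred_eq, h]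
  exact hX.smul hz

theorem neg_conjTranspose_mem_upperHalfMatrices {T : Matrix n n ℂ}
    (hT : T ∈ upperHalfMatrices n) : -Tᴴ ∈ upperHalfMatrices n := by
  rw [upperHalfMatrices, Set.mem_ofPred_eq] at hT ⊢
  convert hT using 2
  simp [add_comm, sub_eq_add_neg]

theorem conjMap_mul_conjMap (Z P : Matrix n n ℂ) :
    conjMap Z P * conjMap Z P = Zᴴ * (P * (Z * Zᴴ) * P) * Z := by
  simp only [conjMap, Matrix.mul_assoc]

theorem conjMap_smul (Z P : Matrix n n ℂ) (c : ℂ) : conjMap Z (c • P) = c • conjMap Z P := by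
  simp [conjMap]

open scoped Matrix.Norms.Operator in
theorem differentiableAt_matrix_trace {W : ℂ → Matrix n n ℂ} {z : ℂ} (h : DifferentiableAt ℂ W z) :
    DifferentiableAt ℂ (fun z => (W z).trace) z :=
  ((LinearMap.toContinuousLinearMap (Matrix.traceLinearMap n ℂ ℂ)).differentiableAt).comp z h

variable [DecidableEq n]

theorem exists_eigenvector {T : Matrix n n ℂ} {w : ℂ} (hw : w ∈ spectrum ℂ T) :
    ∃ v : n → ℂ, v ≠ 0 ∧ T *ᵥ v = w • v := by
  rw [spectrum.mem_iff, Matrix.isUnit_iff_isUnit_det, isUnit_iff_ne_zero, not_not] at hw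
  obtain ⟨v, hv, hv'⟩ := Matrix.exists_mulVec_eq_zero_iff.2 hw
  refine ⟨v, hv, ?_⟩
  rw [Matrix.sub_mulVec, sub_eq_zero, Algebra.algebraMap_eq_smul_one, Matrix.smul_mulVec,
    Matrix.one_mulVec] at hv'
  exact hv'.symm

theorem im_pos_of_mem_spectrum {T : Matrix n n ℂ} (hT : T ∈ upperHalfMatrices n) {w : ℂ}
    (hw : w ∈ spectrum ℂ T) : 0 < w.im := by
  obtain ⟨v, hv, hv'⟩ := exists_eigenvector hw
  have h1 := im_dotProduct_pos_of_mem_upperHalfMatrices hT hv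
  rw [hv', dotProduct_smul, smul_eq_mul] at h1
  have h2 : 0 < star v ⬝ᵥ v := Matrix.dotProduct_star_self_pos_iff.2 hv
  have h3 := Complex.lt_def.1 h2
  simp only [Complex.zero_re, Complex.zero_im] at h3
  rw [Complex.mul_im, ← h3.2, mul_zero, zero_add] at h1
  exact (mul_pos_iff_of_pos_right h3.1).1 h1

theorem conjTranspose_mul_mul_mem_upperHalfMatrices {T Z : Matrix n n ℂ} (hZ : IsUnit Z)
    (hT : T ∈ upperHalfMatrices n) : Zᴴ * T * Z ∈ upperHalfMatrices n := by
  have := Matrix.PosDef.conjTranspose_mul_mul_same (B := Z) hT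
    (Matrix.mulVec_injective_of_isUnit hZ)
  rw [upperHalfMatrices, Set.mem_ofPred_eq]
  convert this using 1
  simp [Matrix.conjTranspose_mul, Matrix.mul_sub, Matrix.sub_mul, Matrix.mul_assoc]

/-- If `KAKv = wv`, put `u = Kv` and `y = Au`. Then `K²y = wu`, so `⟨y, cK²y⟩ = cw⟨u, Au⟩` with `⟨u,
Au⟩ > 0`. The factor `c` lets the same argument bound the sector from either side. -/
theorem im_mul_pos_of_mem_spectrum_mul_mul {K A : Matrix n n ℂ} (hA : A.PosDef) {c w : ℂ}
    (hK : c • (K * K) ∈ upperHalfMatrices n) (hw : w ∈ spectrum ℂ (K * A * K)) :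
    0 < (c * w).im := by
  obtain ⟨v, hv, hv'⟩ := exists_eigenvector hw
  have hu : K *ᵥ v ≠ 0 := fun h => by
    have := im_dotProduct_pos_of_mem_upperHalfMatrices hK hv
    rw [Matrix.smul_mulVec, ← Matrix.mulVec_mulVec, h] at this
    simp at this
  set u := K *ᵥ v with hu_def
  have h2 := Complex.lt_def.1 (hA.dotProduct_mulVec_pos hu)
  simp only [Complex.zero_re, Complex.zero_im] at h2
  have hy : A *ᵥ u ≠ 0 := fun h => by simp [h] at h2
  have h1 := im_dotProduct_pos_of_mem_upperHalfMatrices hK hy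
  have h3 : (K * K) *ᵥ (A *ᵥ u) = w • u := by
    rw [← Matrix.mulVec_mulVec, hu_def, ← Matrix.mulVec_smul, ← hv']
    simp only [Matrix.mulVec_mulVec, Matrix.mul_assoc]
  have h4 : star (A *ᵥ u) ⬝ᵥ u = star u ⬝ᵥ (A *ᵥ u) := by
    rw [Matrix.star_mulVec, hA.1.eq, ← Matrix.dotProduct_mulVec]
  rw [Matrix.smul_mulVec, h3, dotProduct_smul, dotProduct_smul, h4, smul_eq_mul, smul_eq_mul,
    ← mul_assoc, Complex.mul_im, ← h2.2, mul_zero, zero_add] at h1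
  exact (mul_pos_iff_of_pos_right h2.1).1 h1

/-- `Φ_Z(T^{p/2}) A Φ_Z(T^{p/2})` with the analytic powers. -/
noncomputable def pickInner (p : ℝ) (Z A T : Matrix n n ℂ) : Matrix n n ℂ :=
  conjMap Z (matrixCpow T (p / 2)) * A * conjMap Z (matrixCpow T (p / 2))

/-- The spectrum of `Φ_Z(W^{p/2}) A Φ_Z(W^{p/2})` lies in the sector `0 < arg < π p`. -/
theorem sector_of_mem_spectrum_pickInner {p : ℝ} {Z A X H : Matrix n n ℂ} (hZ : IsUnit Z)
    (hA : A.PosDef) (hX : X ∈ pickSetOf p (Z * Zᴴ)) (hH : H.IsHermitian) {z : ℂ} (hz : 0 < z.im)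
    {w : ℂ} (hw : w ∈ spectrum ℂ (pickInner p Z A (z • X + H))) :
    0 < w.im ∧ 0 < (-Complex.exp (-(Real.pi * p * Complex.I)) * w).im := by
  constructor
  · have h1 := conjTranspose_mul_mul_mem_upperHalfMatrices hZ (hX.2 H hH z hz)
    rw [← conjMap_mul_conjMap, ← one_smul ℂ (conjMap _ _ * conjMap _ _)] at h1
    simpa using im_mul_pos_of_mem_spectrum_mul_mul hA h1 hw
  -- The upper edge of the sector comes from the hypothesis at `-H` and `-z̄`, whose matrix is
  -- `-W*`. Negating the adjoint of the product there preserves the positive imaginary part.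
  · set W := z • X + H
    have hW := smul_add_mem_upperHalfMatrices hX.1 hH hz
    have h1 := hX.2 (-H) hH.neg (-star z) (by simpa using hz)
    have h2 : -star z • X + -H = -Wᴴ := by
      simp only [W, Matrix.conjTranspose_add, Matrix.conjTranspose_smul, hX.1.1.eq, hH.eq]
      module
    rw [h2] at h1
    have h3 := conjTranspose_mul_mul_mem_upperHalfMatrices hZ
      (neg_conjTranspose_mem_upperHalfMatrices h1)
    have h4 := conjTranspose_matrixCpow_neg_conjTranspose
      (fun w hw => im_pos_of_mem_spectrum hW hw) (p / 2)
    have h5 : -(matrixCpow (-Wᴴ) (p / 2) * (Z * Zᴴ) * matrixCpow (-Wᴴ) (p / 2))ᴴ =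
        -Complex.exp (-(Real.pi * p * Complex.I)) •
          (matrixCpow W (p / 2) * (Z * Zᴴ) * matrixCpow W (p / 2)) := by
      rw [Matrix.conjTranspose_mul, Matrix.conjTranspose_mul, Matrix.conjTranspose_mul,
        Matrix.conjTranspose_conjTranspose, h4]
      simp only [Matrix.smul_mul, Matrix.mul_smul, smul_smul, ← Complex.exp_add, neg_smul]
      rw [Matrix.mul_assoc (matrixCpow W (p / 2))]
      congr 3
      push_cast; ring
    rw [h5, Matrix.mul_smul, Matrix.smul_mul, ← conjMap_mul_conjMap] at h3
    exact im_mul_pos_of_mem_spectrum_mul_mul hA h3 hw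

/-- The second condition reads `sin (arg w - πp) < 0`, which forces `arg w < πp` because `arg w - πp
< π`. Dividing the argument by `p` then lands in `(0, π)`. -/
theorem im_cpow_pos_of_sector {p : ℝ} (hp0 : 0 < p) (hp1 : p < 1) {w : ℂ} (hw : 0 < w.im)
    (hw' : 0 < (-Complex.exp (-(Real.pi * p * Complex.I)) * w).im) :
    0 < (w ^ ((1 / p : ℝ) : ℂ)).im := by
  have hw0 : w ≠ 0 := fun h => by simp [h] at hw
  have h1 := arg_mem_Ioo_of_im_pos hw
  have hn : 0 < ‖w‖ := norm_pos_iff.2 hw0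
  have h2 : (-Complex.exp (-(Real.pi * p * Complex.I)) * w).im =
      -(‖w‖ * Real.sin (w.arg - Real.pi * p)) := by
    conv_lhs => rw [← Complex.norm_mul_exp_arg_mul_I w]
    rw [neg_mul, Complex.neg_im, mul_left_comm, ← Complex.exp_add,
      show -(Real.pi * p * Complex.I) + w.arg * Complex.I =
        ((w.arg - Real.pi * p : ℝ) : ℂ) * Complex.I by push_cast; ring,
      Complex.im_ofReal_mul, Complex.exp_ofReal_mul_I_im]
  have h3 : w.arg < Real.pi * p := by
    by_contra! h
    rw [h2] at hw'
    have : 0 ≤ Real.sin (w.arg - Real.pi * p) :=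
      Real.sin_nonneg_of_nonneg_of_le_pi (by linarith)
        (by nlinarith [Real.pi_pos])
    nlinarith
  have h4 : (Complex.log w * ((1 / p : ℝ) : ℂ)).im = w.arg / p := by
    rw [mul_comm, Complex.im_ofReal_mul, Complex.log_im]; ring
  rw [Complex.cpow_def_of_ne_zero hw0, Complex.exp_im, h4]
  refine mul_pos (Real.exp_pos _) (Real.sin_pos_of_pos_of_lt_pi (div_pos h1.1 hp0) ?_)
  rwa [div_lt_iff₀ hp0]

theorem spectrum_matrixFun_subset (f : ℂ → ℂ) (T : Matrix n n ℂ) :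
    spectrum ℂ (matrixFun f T) ⊆ f '' spectrum ℂ T := by
  obtain ⟨q, hq⟩ := exists_interpolatesOnSpectrum f T
  rw [matrixFun_eq_aeval hq]
  cases isEmpty_or_nonempty n
  · rw [spectrum.of_subsingleton]; exact Set.empty_subset _
  have h : (spectrum ℂ T).Nonempty := spectrum.nonempty_of_isAlgClosed_of_finiteDimensional ℂ T
  rw [spectrum.map_polynomial_aeval_of_nonempty T q h]
  rintro _ ⟨w, hw, rfl⟩
  refine ⟨w, hw, ?_⟩
  have h1 := hq w 0 ?_
  · simpa using h1.symm
  · rw [Polynomial.rootMultiplicity_pos T.charpoly_monic.ne_zero,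
      ← Matrix.mem_spectrum_iff_isRoot_charpoly]
    exact hw

theorem im_trace_nonneg_of_spectrum {T : Matrix n n ℂ} (h : ∀ w ∈ spectrum ℂ T, 0 ≤ w.im) :
    0 ≤ T.trace.im := by
  rw [Matrix.trace_eq_sum_roots_charpoly, ← Complex.imCLM_apply, map_multiset_sum]
  refine Multiset.sum_nonneg fun x hx => ?_
  obtain ⟨w, hw, rfl⟩ := Multiset.mem_map.1 hx
  refine h w ?_
  rw [Matrix.mem_spectrum_iff_isRoot_charpoly, ← mem_roots T.charpoly_monic.ne_zero]
  exact hw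

/-- The analytic continuation of `pickTrace`. -/
noncomputable def analyticPickTrace (p : ℝ) (Z A T : Matrix n n ℂ) : ℂ :=
  (matrixCpow (pickInner p Z A T) (1 / p)).trace

theorem im_analyticPickTrace_nonneg {p : ℝ} (hp0 : 0 < p) (hp1 : p < 1) {Z A X H : Matrix n n ℂ}
    (hZ : IsUnit Z) (hA : A.PosDef) (hX : X ∈ pickSetOf p (Z * Zᴴ)) (hH : H.IsHermitian) {z : ℂ}
    (hz : 0 < z.im) : 0 ≤ (analyticPickTrace p Z A (z • X + H)).im := by
  refine im_trace_nonneg_of_spectrum fun w hw => ?_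
  obtain ⟨v, hv, rfl⟩ := spectrum_matrixFun_subset _ _ hw
  obtain ⟨h1, h2⟩ := sector_of_mem_spectrum_pickInner hZ hA hX hH hz hv
  exact (im_cpow_pos_of_sector hp0 hp1 h1 h2).le

/-- Each inner power releases `z^{p/2}`, and the outer power turns `z^p` back into `z`. The branches
agree because `p · arg z` stays in `(0, π)` and the scaled inner matrix has its spectrum in the
upper half plane. -/
theorem analyticPickTrace_smul {p : ℝ} (hp0 : 0 < p) (hp1 : p < 1) {Z A X H : Matrix n n ℂ}
    (hZ : IsUnit Z) (hA : A.PosDef) (hX : X ∈ pickSetOf p (Z * Zᴴ)) (hH : H.IsHermitian) {z : ℂ}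
    (hz : 0 < z.im) :
    analyticPickTrace p Z A (z • X + H) = z * analyticPickTrace p Z A (X + z⁻¹ • H) := by
  have hz0 : z ≠ 0 := fun h => by simp [h] at hz
  have hW := smul_add_mem_upperHalfMatrices hX.1 hH hz
  have hsec := fun w hw => (sector_of_mem_spectrum_pickInner hZ hA hX hH hz (w := w) hw).1
  have h1 : z • X + H = z • (X + z⁻¹ • H) := by rw [smul_add, smul_inv_smul₀ hz0]
  rw [h1] at hW hsec ⊢
  have h2 := matrixCpow_smul hz (fun w hw => im_pos_of_mem_spectrum hW hw) (p / 2)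
  have h3 : pickInner p Z A (z • (X + z⁻¹ • H)) = z ^ (p : ℂ) • pickInner p Z A (X + z⁻¹ • H) := by
    rw [pickInner, h2, conjMap_smul, Matrix.smul_mul, Matrix.smul_mul, Matrix.mul_smul, smul_smul,
      ← Complex.cpow_add _ _ hz0]
    congr 2
    push_cast; ring
  have harg := arg_mem_Ioo_of_im_pos hz
  have hlog : (Complex.log z * p).im = z.arg * p := by
    rw [mul_comm, Complex.im_ofReal_mul, Complex.log_im]; ring
  have hlt : z.arg * p < Real.pi := by nlinarith [Real.pi_pos]
  have hzp : 0 < (z ^ (p : ℂ)).im := by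
    rw [Complex.cpow_def_of_ne_zero hz0, Complex.exp_im, hlog]
    exact mul_pos (Real.exp_pos _) (Real.sin_pos_of_pos_of_lt_pi (mul_pos harg.1 hp0) hlt)
  have h4 : (z ^ (p : ℂ)) ^ ((1 / p : ℝ) : ℂ) = z := by
    rw [← Complex.cpow_mul, ← Complex.ofReal_mul, mul_one_div_cancel hp0.ne', Complex.ofReal_one,
      Complex.cpow_one]
    · rw [hlog]; nlinarith [Real.pi_pos]
    · rw [hlog]; exact hlt.le
  rw [analyticPickTrace, h3]
  rw [h3] at hsec
  rw [matrixCpow_smul hzp hsec, h4, Matrix.trace_smul, smul_eq_mul, analyticPickTrace]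

theorem posDef_conjMap {Z X : Matrix n n ℂ} (hZ : IsUnit Z) (hX : X.PosDef) :
    (conjMap Z X).PosDef :=
  hX.conjTranspose_mul_mul_same (Matrix.mulVec_injective_of_isUnit hZ)

theorem posDef_pickInner {p : ℝ} {Z A X : Matrix n n ℂ} (hZ : IsUnit Z) (hA : A.PosDef)
    (hX : X.PosDef) : (pickInner p Z A X).PosDef := by
  rw [pickInner, matrixCpow_eq_rpow hX]
  have h := posDef_conjMap hZ (posDef_rpow hX (p / 2))
  have := hA.conjTranspose_mul_mul_same (Matrix.mulVec_injective_of_isUnit h.isUnit)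
  rwa [h.1.eq] at this

theorem analyticPickTrace_eq_pickTrace {p : ℝ} {Z A X : Matrix n n ℂ} (hZ : IsUnit Z)
    (hA : A.PosDef) (hX : X.PosDef) : analyticPickTrace p Z A X = pickTrace p Z A X := by
  have h := posDef_pickInner (p := p) hZ hA hX
  have h1 : analyticPickTrace p Z A X = (pickInner p Z A X ^ (1 / p)).trace := by
    rw [analyticPickTrace, matrixCpow_eq_rpow h]
  have h2 : 0 ≤ (pickInner p Z A X ^ (1 / p)).trace := (posDef_rpow h (1 / p)).posSemidef.trace_nonneg
  rw [h1, pickTrace, ← matrixCpow_eq_rpow hX]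
  exact Complex.eq_re_of_ofReal_le h2

theorem re_pos_of_mem_spectrum {X : Matrix n n ℂ} (hX : X.PosDef) {w : ℂ}
    (hw : w ∈ spectrum ℂ X) : 0 < w.re := by
  rw [hX.1.spectrum_eq_image_range] at hw
  obtain ⟨_, ⟨i, rfl⟩, rfl⟩ := hw
  simpa using hX.eigenvalues_pos i

open scoped Matrix.Norms.Operator

theorem differentiableAt_pickInner {p : ℝ} {Z A : Matrix n n ℂ} {W : ℂ → Matrix n n ℂ} {z : ℂ}
    (h : DifferentiableAt ℂ (fun z => matrixCpow (W z) (p / 2)) z) :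
    DifferentiableAt ℂ (fun z => pickInner p Z A (W z)) z := by
  unfold pickInner conjMap
  fun_prop

theorem differentiableAt_analyticPickTrace_of_im_pos {p : ℝ} {Z A X H : Matrix n n ℂ}
    (hZ : IsUnit Z) (hA : A.PosDef) (hX : X ∈ pickSetOf p (Z * Zᴴ)) (hH : H.IsHermitian) {z : ℂ}
    (hz : 0 < z.im) : DifferentiableAt ℂ (fun z => analyticPickTrace p Z A (z • X + H)) z := by
  have h1 : ∀ᶠ z : ℂ in 𝓝 z, DifferentiableAt ℂ (fun z : ℂ => z • X + H) z :=
    Eventually.of_forall fun z => by fun_prop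
  have h2 := eventually_differentiableAt_matrixCpow_of_im_pos h1
    (fun w hw => im_pos_of_mem_spectrum (smul_add_mem_upperHalfMatrices hX.1 hH hz) hw) (p / 2)
  -- Powers are nested, so the inner one must be holomorphic on a neighbourhood, not merely at `z`.
  have h3 := eventually_differentiableAt_matrixCpow_of_im_pos
    (h2.mono fun z hz => differentiableAt_pickInner (Z := Z) (A := A) hz)
    (fun w hw => (sector_of_mem_spectrum_pickInner hZ hA hX hH hz hw).1) (1 / p)
  exact differentiableAt_matrix_trace h3.self_of_nhds

theorem eventually_differentiableAt_analyticPickTrace {p : ℝ} {Z A : Matrix n n ℂ}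
    (hZ : IsUnit Z) (hA : A.PosDef) {W : ℂ → Matrix n n ℂ} (hW : Differentiable ℂ W) {z : ℂ}
    (hX : (W z).PosDef) :
    ∀ᶠ z in 𝓝 z, DifferentiableAt ℂ (fun z => analyticPickTrace p Z A (W z)) z := by
  have h1 : ∀ᶠ z : ℂ in 𝓝 z, DifferentiableAt ℂ W z := Eventually.of_forall fun z => hW z
  have h2 := eventually_differentiableAt_matrixCpow_of_re_pos h1
    (fun w hw => re_pos_of_mem_spectrum hX hw) (p / 2)
  have h3 := eventually_differentiableAt_matrixCpow_of_re_pos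
    (h2.mono fun z hz => differentiableAt_pickInner (Z := Z) (A := A) hz)
    (fun w hw => re_pos_of_mem_spectrum (posDef_pickInner hZ hA hX) hw) (1 / p)
  exact h3.mono fun z hz => differentiableAt_matrix_trace hz

end Sector

/-! ### Pick functions and their expansion at infinity. -/

section Herglotz

open scoped Topology
open Filter

/-- A holomorphic function on the upper half plane with nonnegative imaginary part at infinity
and on the real line has nonnegative imaginary part. -/
theorem im_nonneg_of_boundary {h : ℂ → ℂ} {D : ℝ}
    (hd : ∀ z : ℂ, 0 < z.im → DifferentiableAt ℂ h z)
    (hreal : ∀ z : ℂ, 0 < z.im → -(D * z.im) ≤ (h z).im) {C R₀ : ℝ} (hC : 0 ≤ C) (hD : 0 ≤ D)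
    (hinf : ∀ z : ℂ, 0 < z.im → R₀ < ‖z‖ → -(C / ‖z‖) ≤ (h z).im) {z : ℂ} (hz : 0 < z.im) :
    0 ≤ (h z).im := by
  have key : ∀ᶠ R : ℝ in atTop, -((C + D) / R) ≤ (h z).im := by
    filter_upwards [eventually_gt_atTop R₀, eventually_gt_atTop ‖z‖, eventually_gt_atTop (1 / z.im)]
      with R hR0 hRz hRi
    have hRpos : 0 < R := (norm_nonneg z).trans_lt hRz
    have hRi' : 1 / R < z.im := by
      rw [div_lt_iff₀ hRpos]; rwa [div_lt_iff₀ hz, mul_comm] at hRi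
    -- The domain stays at height `1 / R` because `h` is not controlled on the real line itself. The
    -- flat side costs at most `D / R`, the arc at most `C / R`.
    let U : Set ℂ := {w | 1 / R < w.im} ∩ Metric.ball 0 R
    have hUo : IsOpen U :=
      (isOpen_lt continuous_const Complex.continuous_im).inter Metric.isOpen_ball
    have hUc : closure U ⊆ {w | 1 / R ≤ w.im} ∩ Metric.closedBall 0 R :=
      closure_minimal (Set.inter_subset_inter (fun w (hw : 1 / R < w.im) => hw.le)
        Metric.ball_subset_closedBall)
        ((isClosed_le continuous_const Complex.continuous_im).inter Metric.isClosed_closedBall)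
    have hpos : ∀ w ∈ closure U, 0 < w.im := fun w hw =>
      (by positivity : 0 < 1 / R).trans_le (hUc hw).1
    -- Maximum modulus is applied to `exp (i h)`, whose modulus is `exp (-Im h)`.
    have hdiff : DiffContOnCl ℂ (fun w => Complex.exp (Complex.I * h w)) U := by
      refine DifferentiableOn.diffContOnCl fun w hw => ?_
      have := hd w (hpos w hw)
      exact DifferentiableAt.differentiableWithinAt (by fun_prop)
    have hnorm : ∀ w, ‖Complex.exp (Complex.I * h w)‖ = Real.exp (-(h w).im) := fun w => by
      rw [Complex.norm_exp]; simp
    have hbd : ∀ w ∈ frontier U, ‖Complex.exp (Complex.I * h w)‖ ≤ Real.exp ((C + D) / R) := by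
      intro w hw
      rw [hnorm, Real.exp_le_exp]
      have hwc := frontier_subset_closure hw
      have hwU : w ∉ U := by
        rw [hUo.frontier_eq] at hw; exact hw.2
      have hwi := hpos w hwc
      have h0 : 0 ≤ C / R := by positivity
      have h1 : 0 ≤ D / R := by positivity
      rw [add_div]
      by_cases hwR : ‖w‖ < R
      · have h2 : w.im ≤ 1 / R := by
          by_contra! h2
          exact hwU ⟨h2, by simpa using hwR⟩
        have h3 := hreal w hwi
        have h4 : D * w.im ≤ D * (1 / R) := by gcongr
        rw [mul_one_div] at h4
        linarith
      · have h2 : ‖w‖ = R := le_antisymm (by simpa using (hUc hwc).2) (not_lt.1 hwR)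
        have h3 := hinf w hwi (by rw [h2]; exact hR0)
        rw [h2] at h3
        linarith
    have hzU : z ∈ closure U := subset_closure ⟨hRi', by simpa using hRz⟩
    have h5 := Complex.norm_le_of_forall_mem_frontier_norm_le
      (Metric.isBounded_ball.subset Set.inter_subset_right) hdiff hbd hzU
    rw [hnorm, Real.exp_le_exp] at h5
    linarith
  have hlim : Tendsto (fun R : ℝ => -((C + D) / R)) atTop (𝓝 0) := by
    simpa using ((tendsto_const_nhds (x := C + D)).div_atTop (tendsto_id (α := ℝ))).neg
  exact le_of_tendsto hlim key

theorem exists_taylor_two_bound {F : ℂ → ℂ} (hF : ∀ᶠ z in 𝓝 0, DifferentiableAt ℂ F z) :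
    ∃ C δ : ℝ, 0 < C ∧ 0 < δ ∧ ∀ z : ℂ, ‖z‖ < δ →
      ‖F z - (F 0 + deriv F 0 * z + deriv (deriv F) 0 / 2 * z ^ 2)‖ ≤ C * ‖z‖ ^ 3 := by
  have ha : AnalyticAt ℂ F 0 := Complex.analyticAt_iff_eventually_differentiableAt.2 hF
  have h1 := ha.hasFPowerSeriesAt.isBigO_sub_partialSum_pow 3
  obtain ⟨C, hC, h2⟩ := h1.exists_pos
  obtain ⟨δ, hδ, h3⟩ := Metric.eventually_nhds_iff.1 h2.bound
  refine ⟨C, δ, hC, hδ, fun z hz => ?_⟩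
  have h4 := h3 (y := z) (by simpa using hz)
  have h5 : FormalMultilinearSeries.partialSum (FormalMultilinearSeries.ofScalars ℂ
      fun n => iteratedDeriv n F 0 / n.factorial) 3 z =
      F 0 + deriv F 0 * z + deriv (deriv F) 0 / 2 * z ^ 2 := by
    simp [FormalMultilinearSeries.partialSum, Finset.sum_range_succ, iteratedDeriv_succ]
    ring
  rwa [zero_add, norm_pow, norm_norm, h5] at h4

/-- The second Taylor coefficient of `F` at `0` is the `1/z` coefficient of `z F(1/z)` at infinity.
Once the linear term is removed, the Pick property determines its sign. -/
theorem re_deriv_two_nonpos_of_pick {F : ℂ → ℂ} (hF : ∀ᶠ z in 𝓝 0, DifferentiableAt ℂ F z)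
    (hreal : ∀ᶠ t : ℝ in 𝓝 0, (F t).im = 0)
    (hd : ∀ z : ℂ, 0 < z.im → DifferentiableAt ℂ (fun z => z * F z⁻¹) z)
    (him : ∀ z : ℂ, 0 < z.im → 0 ≤ (z * F z⁻¹).im) :
    (deriv (deriv F) 0).re ≤ 0 := by
  obtain ⟨C, δ, hC, hδ, hT⟩ := exists_taylor_two_bound hF
  have h0 : (F 0).im = 0 := by simpa using hreal.self_of_nhds
  have h1 : (deriv F 0).im = 0 := by
    have h2 : HasDerivAt F (deriv F 0) ((0 : ℝ) : ℂ) := by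
      simpa using hF.self_of_nhds.hasDerivAt
    have h3 : HasDerivAt (fun t : ℝ => (F t).im) (deriv F 0).im 0 := by
      have := (Complex.imCLM.hasFDerivAt (x := F ((0 : ℝ) : ℂ))).comp_hasDerivAt (0 : ℝ)
        h2.comp_ofReal
      exact this
    have h4 : HasDerivAt (fun t : ℝ => (F t).im) 0 0 :=
      (hasDerivAt_const (0 : ℝ) (0 : ℝ)).congr_of_eventuallyEq hreal
    exact h3.unique h4
  set F0 := F 0
  set F1 := deriv F 0
  set F2 := deriv (deriv F) 0
  have hF0 : F0 = (F0.re : ℂ) := Complex.ext rfl (by simpa using h0)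
  have hexp : ∀ z : ℂ, 0 < z.im → 1 / δ < ‖z‖ →
      ‖z * F z⁻¹ - F0 * z - F1 - F2 / 2 * z⁻¹‖ ≤ C / ‖z‖ ^ 2 := by
    intro z hz hzδ
    have hz0 : z ≠ 0 := fun h => by simp [h] at hz
    have hn : 0 < ‖z‖ := norm_pos_iff.2 hz0
    have h3 := hT z⁻¹ (by
      rw [norm_inv, inv_lt_comm₀ hn hδ, ← one_div]; exact hzδ)
    have h4 : z * F z⁻¹ - F0 * z - F1 - F2 / 2 * z⁻¹ =
        z * (F z⁻¹ - (F0 + F1 * z⁻¹ + F2 / 2 * z⁻¹ ^ 2)) := by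
      field_simp
      ring
    rw [h4, norm_mul]
    calc ‖z‖ * ‖F z⁻¹ - (F0 + F1 * z⁻¹ + F2 / 2 * z⁻¹ ^ 2)‖
        ≤ ‖z‖ * (C * ‖z⁻¹‖ ^ 3) := by gcongr
      _ = C / ‖z‖ ^ 2 := by rw [norm_inv]; field_simp
  -- Near the real line, subtracting `F0 * z` with `F0` real loses at most `|F0| Im z`. Near
  -- infinity, `F1` is real, so the remaining imaginary part is `O(1/‖z‖)`.
  have hpos : ∀ z : ℂ, 0 < z.im → 0 ≤ (z * F z⁻¹ - F0 * z).im := by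
    intro z hz
    refine im_nonneg_of_boundary (h := fun z => z * F z⁻¹ - F0 * z) (D := |F0.re|)
      (C := ‖F2 / 2‖ + C) (R₀ := max (1 / δ) 1)
      (fun w hw => (hd w hw).sub (by fun_prop)) ?_ (by positivity) (abs_nonneg _) ?_ hz
    · intro w hw
      have h3 := him w hw
      have h4 : (F0 * w).im = F0.re * w.im := by rw [hF0]; simp
      rw [Complex.sub_im, h4]
      have := mul_le_mul_of_nonneg_right (le_abs_self F0.re) hw.le
      linarith
    · intro w hw hwR
      have hw1 : 1 < ‖w‖ := (le_max_right _ _).trans_lt hwR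
      have h3 := hexp w hw ((le_max_left _ _).trans_lt hwR)
      have h4 : (w * F w⁻¹ - F0 * w).im =
          (w * F w⁻¹ - F0 * w - F1 - F2 / 2 * w⁻¹).im + (F2 / 2 * w⁻¹).im := by
        simp only [Complex.sub_im, h1]; ring
      have h5 := neg_le_of_abs_le ((Complex.abs_im_le_norm _).trans h3)
      have h6 := neg_le_of_abs_le (Complex.abs_im_le_norm (F2 / 2 * w⁻¹))
      rw [norm_mul, norm_inv, ← div_eq_mul_inv] at h6
      have h7 : C / ‖w‖ ^ 2 ≤ C / ‖w‖ := by
        gcongr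
        nlinarith
      rw [add_div, h4]
      linarith
  -- At `z = iy` the term `F2 / (2z)` has imaginary part `-Re F2 / (2y)`, which the `C / y²` error
  -- cannot offset for large `y` if `Re F2 > 0`.
  have hfin : ∀ᶠ y : ℝ in atTop, F2.re ≤ 2 * C / y := by
    filter_upwards [eventually_gt_atTop (1 / δ), eventually_gt_atTop 0] with y hy hy0
    have hyn : ‖(y : ℂ) * Complex.I‖ = y := by simp [abs_of_pos hy0]
    have hyi : 0 < ((y : ℂ) * Complex.I).im := by simpa using hy0
    have h3 := hpos _ hyi
    have h4 := hexp _ hyi (by rwa [hyn])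
    have h5 := (le_abs_self _).trans ((Complex.abs_im_le_norm _).trans h4)
    rw [hyn] at h5
    have h6 : (F2 / 2 * ((y : ℂ) * Complex.I)⁻¹).im = -(F2.re / (2 * y)) := by
      rw [mul_inv, Complex.inv_I, ← Complex.ofReal_inv]
      simp
      field_simp
    rw [Complex.sub_im, Complex.sub_im, h1, h6] at h5
    have h7 : F2.re / (2 * y) ≤ C / y ^ 2 := by linarith
    rw [div_le_iff₀ (by positivity)] at h7
    calc F2.re ≤ C / y ^ 2 * (2 * y) := h7
      _ = 2 * C / y := by field_simp
  exact ge_of_tendsto (tendsto_const_nhds.div_atTop tendsto_id) hfin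

end Herglotz

/-! ### Concavity along segments and on convex sets. -/

section Concavity

open scoped Topology
open Filter Polynomial

variable {n : Type*} [Fintype n] [DecidableEq n]

open scoped Matrix

theorem pickSet_subset_pickSetOf {p : ℝ} (hp0 : 0 < p) (hp1 : p ≤ 1) {B : Matrix n n ℂ}
    (hB : B.PosDef) : pickSet n ⊆ pickSetOf p B :=
  fun _ hX => ⟨hX.1, fun H hH z hz => hX.2 H hH z hz p hp0 hp1 B hB⟩

open scoped Matrix.Norms.Operator in
theorem concaveOn_pickTrace_segment {p : ℝ} (hp0 : 0 < p) (hp1 : p < 1) {Z A X H : Matrix n n ℂ}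
    (hZ : IsUnit Z) (hA : A.PosDef) (hH : H.IsHermitian)
    (hX : ∀ t ∈ Set.Icc (0 : ℝ) 1, X + (t : ℂ) • H ∈ pickSetOf p (Z * Zᴴ)) :
    ConcaveOn ℝ (Set.Icc (0 : ℝ) 1) fun t => pickTrace p Z A (X + (t : ℂ) • H) := by
  let F : ℂ → ℂ := fun z => analyticPickTrace p Z A (X + z • H)
  have hFt : ∀ t ∈ Set.Icc (0 : ℝ) 1, F t = pickTrace p Z A (X + (t : ℂ) • H) := fun t ht =>
    analyticPickTrace_eq_pickTrace hZ hA (hX t ht).1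
  have hFd : ∀ t ∈ Set.Icc (0 : ℝ) 1, ∀ᶠ z in 𝓝 (t : ℂ), DifferentiableAt ℂ F z := fun t ht =>
    eventually_differentiableAt_analyticPickTrace hZ hA (W := fun z => X + z • H)
      (by fun_prop) (hX t ht).1
  have hF2 : ∀ t ∈ Set.Ioo (0 : ℝ) 1, (deriv (deriv F) t).re ≤ 0 := by
    intro t ht
    have htI := Set.Ioo_subset_Icc_self ht
    have hcont : Tendsto (fun z : ℂ => (t : ℂ) + z) (𝓝 0) (𝓝 t) :=
      Continuous.tendsto' (by fun_prop) _ _ (by simp)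
    -- Homogeneity with base point `X + tH`: the matrix `z(X + tH) + H` is `z` times `X + (t +
    -- z⁻¹)H`. Only the base point has to lie in the Pick set, while the direction `H` is an
    -- arbitrary Hermitian matrix.
    have hscale : ∀ z : ℂ, 0 < z.im →
        z * F (t + z⁻¹) = analyticPickTrace p Z A (z • (X + (t : ℂ) • H) + H) := fun z hz => by
      rw [analyticPickTrace_smul hp0 hp1 hZ hA (hX t htI) hH hz, add_assoc, ← add_smul]
    have h1 := re_deriv_two_nonpos_of_pick (F := fun z => F (t + z)) ?_ ?_ ?_ ?_
    · have h2 : deriv (fun z => F (t + z)) = fun z => deriv F (t + z) :=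
        funext fun z => deriv_comp_const_add _ _ _
      rw [h2, deriv_comp_const_add, add_zero] at h1
      exact h1
    · filter_upwards [hcont.eventually (hFd t htI)] with z hz
      exact hz.comp z (by fun_prop : DifferentiableAt ℂ (fun z : ℂ => (t : ℂ) + z) z)
    · have h2 : ∀ᶠ s : ℝ in 𝓝 0, t + s ∈ Set.Ioo (0 : ℝ) 1 :=
        (Continuous.tendsto' (by fun_prop) _ _ (by simp) :
          Tendsto (fun s : ℝ => t + s) (𝓝 0) (𝓝 t)).eventually (Ioo_mem_nhds ht.1 ht.2)
      filter_upwards [h2] with s hs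
      rw [← Complex.ofReal_add, hFt _ (Set.Ioo_subset_Icc_self hs), Complex.ofReal_im]
    · intro z hz
      refine (differentiableAt_analyticPickTrace_of_im_pos hZ hA (hX t htI) hH
        hz).congr_of_eventuallyEq ?_
      filter_upwards [(isOpen_lt continuous_const Complex.continuous_im).mem_nhds hz] with w hw
      exact hscale w hw
    · intro z hz
      rw [hscale z hz]
      exact im_analyticPickTrace_nonneg hp0 hp1 hZ hA (hX t htI) hH hz
  have hre : ConcaveOn ℝ (Set.Icc (0 : ℝ) 1) fun t : ℝ => (F t).re := by
    refine concaveOn_of_hasDerivWithinAt2_nonpos (convex_Icc 0 1)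
      (f' := fun t => (deriv F t).re) (f'' := fun t => (deriv (deriv F) t).re)
      (fun t ht => ?_) (fun t ht => ?_) (fun t ht => ?_) (fun t ht => ?_)
    · exact (HasDerivAt.real_of_complex
        (hFd t ht).self_of_nhds.hasDerivAt).continuousAt.continuousWithinAt
    · exact (HasDerivAt.real_of_complex
        (hFd t (interior_subset ht)).self_of_nhds.hasDerivAt).hasDerivWithinAt
    · have ha : AnalyticAt ℂ F t :=
        Complex.analyticAt_iff_eventually_differentiableAt.2 (hFd t (interior_subset ht))
      exact (HasDerivAt.real_of_complex ha.deriv.differentiableAt.hasDerivAt).hasDerivWithinAt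
    · rw [interior_Icc] at ht
      exact hF2 t ht
  refine hre.congr fun t ht => ?_
  simp only [hFt t ht, Complex.ofReal_re]

theorem concaveOn_pickTrace_of_subset_pickSetOf {p : ℝ} (hp0 : 0 < p) (hp1 : p < 1)
    {Z A : Matrix n n ℂ} (hZ : IsUnit Z) (hA : A.PosDef) {S : Set (Matrix n n ℂ)}
    (hS : Convex ℝ S) (hSp : S ⊆ pickSetOf p (Z * Zᴴ)) : ConcaveOn ℝ S (pickTrace p Z A) := by
  refine ⟨hS, fun X hX Y hY a b ha hb hab => ?_⟩
  have hseg : ∀ s t : ℝ, s + t = 1 → X + (t : ℂ) • (Y - X) = s • X + t • Y := fun s t hst => by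
    rw [Complex.coe_smul, ← eq_sub_iff_add_eq] at *
    rw [hst]; module
  -- Concavity on `S` is concavity on the segment from `X` to `Y`, which has Hermitian direction `Y
  -- - X` and stays in `S` by convexity.
  have hc := concaveOn_pickTrace_segment hp0 hp1 hZ hA (X := X) (H := Y - X)
    ((hSp hY).1.1.sub (hSp hX).1.1) fun t ht => by
      rw [hseg (1 - t) t (by ring)]
      exact hSp (hS hX hY (by linarith [ht.2]) ht.1 (by ring))
  have h1 := hc.2 (Set.left_mem_Icc.2 zero_le_one) (Set.right_mem_Icc.2 zero_le_one) ha hb hab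
  simp only [smul_eq_mul, mul_zero, mul_one, zero_add, Complex.ofReal_zero, zero_smul, add_zero,
    Complex.ofReal_one, one_smul, add_sub_cancel] at h1
  rwa [hseg a b hab] at h1

end Concavity

theorem mainTheorem4 {n : Type*} [Fintype n] [DecidableEq n] (p : ℝ) (hp0 : 0 < p) (hp1 : p < 1)
    (Z A : Matrix n n ℂ) (hZ : IsUnit Z) (hA : A.PosDef)
    (S : Set (Matrix n n ℂ)) (hS : Convex ℝ S) :
    (S ⊆ pickSet n → ConcaveOn ℝ S (pickTrace p Z A)) ∧
      (S ⊆ pickSetOf p (Z * Z.conjTranspose) → ConcaveOn ℝ S (pickTrace p Z A)) := by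
  have hZZ : (Z * Z.conjTranspose).PosDef :=
    Matrix.PosDef.mul_conjTranspose_self Z (Matrix.vecMul_injective_of_isUnit hZ)
  exact ⟨fun h => concaveOn_pickTrace_of_subset_pickSetOf hp0 hp1 hZ hA hS
    (h.trans (pickSet_subset_pickSetOf hp0 hp1.le hZZ)),
    concaveOn_pickTrace_of_subset_pickSetOf hp0 hp1 hZ hA hS⟩
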